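/- Let $S^1\subset\mathbb{C}$ be the unit circle, let $m\ge 0$, and let $K:S^1\to\mathbb{R}^m$ be a continuous map (not necessarily injective), where $\mathbb{R}^m$ carries the Euclidean norm. Let $x_0\in S^1$ be a point such that (i) $K$ has a nonzero continuous derivative in a neighbourhood of $x_0$; that is, for some neighbourhood $U$ of $x_0$ in $S^1$, the map $\theta\mapsto K(e^{i\theta})$ is differentiable at every $\theta$ with $e^{i\theta}\in U$, and its derivative there is nonzero and depends continuously on $\theta$; (ii) $K(x)\neq K(x_0)$ for all $x\in S^1$ with $x\neq x_0$. Then for every integer $n\ge 1$ there is a regular $n$-gon inscribing $K$ that has $x_0$ as a vertex. That is, there are $n$ distinct points $y_0,\dots,y_{n-1}\in S^1$, lying on $S^1$ in this cyclic order, one of which is $x_0$, such that, with $y_n=y_0$, the distances $\|K(y_{i-1})-K(y_i)\|$, $i=1,\dots,n$, are all the same, and, if $n\ge 2$, this common distance is positive. -/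

import Mathlib

open Topology

/-- A map `K` from the unit circle has a nonzero continuous derivative in a neighbourhood of `x₀`.
The derivative is taken with respect to the angle `θ`, where the point of angle `θ` is
`Circle.exp θ = e^{iθ}`. -/
def HasNonzeroContinuousDerivNear {E : Type*} [NormedAddCommGroup E] [NormedSpace ℝ E]
    (K : Circle → E) (x₀ : Circle) : Prop :=
  ∃ U ∈ 𝓝 x₀,
    (∀ θ : ℝ, Circle.exp θ ∈ U →
      DifferentiableAt ℝ (fun s : ℝ => K (Circle.exp s)) θ ∧
        deriv (fun s : ℝ => K (Circle.exp s)) θ ≠ 0) ∧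
    ContinuousOn (deriv (fun s : ℝ => K (Circle.exp s))) {θ : ℝ | Circle.exp θ ∈ U}

/-- The points `x 0, …, x (n - 1)` are distinct and lie in this (counterclockwise) cyclic order on
the unit circle: they have increasing angles within a single turn. -/
def InCyclicOrder {n : ℕ} (x : Fin n → Circle) : Prop :=
  ∃ θ : Fin n → ℝ, StrictMono θ ∧ (∀ i j, θ j < θ i + 2 * Real.pi) ∧
    ∀ i, Circle.exp (θ i) = x i

/-- The points `K (x 0), …, K (x (n - 1))` are the successive vertices of a regular `n`-gon
inscribing the closed curve `K`: the parameters lie in cyclic order on the circle and the `n`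
distances between cyclically adjacent vertices (`finRotate n` is `i ↦ i + 1` modulo `n`) are all
the same. For `n ≥ 2` the common edge length is required to be positive, so that the polygon does
not degenerate to a point. -/
structure IsInscribedRegularPolygon {E : Type*} [NormedAddCommGroup E]
    (K : Circle → E) (n : ℕ) (x : Fin n → Circle) : Prop where
  cyclic : InCyclicOrder x
  equal_edges : ∃ d : ℝ, (2 ≤ n → 0 < d) ∧ ∀ i, ‖K (x i) - K (x (finRotate n i))‖ = d

/-! Parametrize the curve with period 1 as `κ`, starting at x₀. Chains 0 = t₀ ≤ … ≤ t_{d+1} = 1 are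
the running maxima of points of the cube [0,1]^d, and equality of consecutive step sizes gives d
equations whose signs on opposite faces suit Poincaré–Miranda (`exists_zero_of_cube`,
`exists_equal_steps`).

With chord length alone, the solution could be one jump from 0 to 1 and no other movement. So the
step size is chord length plus a penalty for parameter steps longer than 1 - δ. The common value D
is then positive, because x₀ is visited only once. If one step were long, all others would lie near
x₀, where the curve is almost straight: the d ≥ 2 other chords of length D together span about the
chord of the long step, which is at most D, a contradiction (`exists_equilateral_chain`). So the
penalty vanishes and all chords equal D. The cases n ≤ 2 are direct.

Poincaré–Miranda comes from a mod 2 count over Kuhn simplices that depends only on the boundary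
labels (`kuhnSum_congr`). -/

/-! ### Kuhn simplices and the discrete Poincaré–Miranda theorem -/

/-- The `i`-th vertex of the Kuhn simplex at the lattice point `x` that takes the step in
direction `c` at time `τ c`. -/
def kuhnVertex {d : ℕ} (τ : Equiv.Perm (Fin d)) (x : Fin d → ℤ) (i : ℕ) : Fin d → ℤ :=
  fun c => x c + if (τ c : ℕ) < i then 1 else 0

/-- The increment (modulo 2) of `f` along the `i`-th step of a Kuhn simplex. -/
def kuhnDiff {d : ℕ} (f : (Fin d → ℤ) → ZMod 2) (τ : Equiv.Perm (Fin d)) (x : Fin d → ℤ)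
    (i : ℕ) : ZMod 2 :=
  f (kuhnVertex τ x (i + 1)) + f (kuhnVertex τ x i)

/-- The value of `f` at the `p`-th vertex, times the increments of the functions `G r` along all
steps but the `s`-th one. -/
def kuhnSkip {e : ℕ} (f : (Fin (e + 1) → ℤ) → ZMod 2) (G : Fin e → (Fin (e + 1) → ℤ) → ZMod 2)
    (p s : ℕ) (x : Fin (e + 1) → ℤ) (τ : Equiv.Perm (Fin (e + 1))) : ZMod 2 :=
  f (kuhnVertex τ x p) * ∏ r : Fin e, kuhnDiff (G r) τ x (if (r : ℕ) < s then r else r + 1)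

theorem kuhnVertex_swap {d : ℕ} (τ : Equiv.Perm (Fin d)) (x : Fin d → ℤ) {s i : ℕ}
    (hs : s + 1 < d) (hi : i ≠ s + 1) :
    kuhnVertex (Equiv.swap (⟨s, by omega⟩ : Fin d) ⟨s + 1, hs⟩ * τ) x i = kuhnVertex τ x i := by
  funext c
  have : ((Equiv.swap (⟨s, by omega⟩ : Fin d) ⟨s + 1, hs⟩ (τ c) : Fin d) : ℕ) < i ↔
      (τ c : ℕ) < i := by
    rw [Equiv.swap_apply_def]
    split_ifs with h1 h2
    · rw [h1]; simp only; omega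
    · rw [h2]; simp only; omega
    · rfl
  simp only [kuhnVertex, Equiv.Perm.mul_apply, this]

/-- The sum of the two summands telescopes past vertex `s + 1`. Swapping the steps `s` and `s + 1`
moves only that vertex, so simplices cancel in pairs. -/
theorem sum_kuhnSkip_succ {e : ℕ} (f : (Fin (e + 1) → ℤ) → ZMod 2)
    (G : Fin e → (Fin (e + 1) → ℤ) → ZMod 2) {p s : ℕ} (hs : s < e) (hp : p ≠ s + 1)
    (x : Fin (e + 1) → ℤ) :
    ∑ τ, kuhnSkip f G p s x τ = ∑ τ, kuhnSkip f G p (s + 1) x τ := by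
  have key : ∀ τ, kuhnSkip f G p s x τ + kuhnSkip f G p (s + 1) x τ =
      f (kuhnVertex τ x p) * ((G ⟨s, hs⟩ (kuhnVertex τ x (s + 2)) + G ⟨s, hs⟩ (kuhnVertex τ x s)) *
        ∏ r ∈ Finset.univ.erase (⟨s, hs⟩ : Fin e),
          kuhnDiff (G r) τ x (if (r : ℕ) < s then r else r + 1)) := by
    intro τ
    have h2 : ∏ r ∈ Finset.univ.erase (⟨s, hs⟩ : Fin e),
          kuhnDiff (G r) τ x (if (r : ℕ) < s + 1 then r else r + 1) =
        ∏ r ∈ Finset.univ.erase (⟨s, hs⟩ : Fin e),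
          kuhnDiff (G r) τ x (if (r : ℕ) < s then r else r + 1) := by
      refine Finset.prod_congr rfl fun r hr => ?_
      have : (r : ℕ) ≠ s := fun h => (Finset.mem_erase.1 hr).1 (Fin.ext h)
      congr 1
      split_ifs <;> omega
    unfold kuhnSkip
    rw [← Finset.mul_prod_erase _ _ (Finset.mem_univ (⟨s, hs⟩ : Fin e)),
      ← Finset.mul_prod_erase _ (fun r : Fin e => kuhnDiff (G r) τ x
        (if (r : ℕ) < s + 1 then (r : ℕ) else r + 1)) (Finset.mem_univ (⟨s, hs⟩ : Fin e)), h2]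
    simp only [lt_irrefl, if_false, Nat.lt_succ_self, if_true, kuhnDiff]
    linear_combination (f (kuhnVertex τ x p) * ∏ r ∈ Finset.univ.erase (⟨s, hs⟩ : Fin e),
          (G r (kuhnVertex τ x ((if (r : ℕ) < s then (r : ℕ) else r + 1) + 1)) +
            G r (kuhnVertex τ x (if (r : ℕ) < s then (r : ℕ) else r + 1)))) *
      CharTwo.add_self_eq_zero (G ⟨s, hs⟩ (kuhnVertex τ x (s + 1)))
  rw [← CharTwo.add_eq_zero, ← Finset.sum_add_distrib]
  simp only [key]
  have hs' : s + 1 < e + 1 := by omega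
  refine Finset.sum_involution
    (fun τ _ => Equiv.swap (⟨s, by omega⟩ : Fin (e + 1)) ⟨s + 1, hs'⟩ * τ) ?_ ?_ ?_ ?_
  · intro τ _
    rw [CharTwo.add_eq_zero]
    rw [kuhnVertex_swap τ x hs' hp, kuhnVertex_swap τ x hs' (by omega),
      kuhnVertex_swap τ x hs' (by omega)]
    congr 2
    refine Finset.prod_congr rfl fun r hr => ?_
    have : (r : ℕ) ≠ s := fun h => (Finset.mem_erase.1 hr).1 (Fin.ext h)
    unfold kuhnDiff
    rw [kuhnVertex_swap τ x hs' (by split_ifs <;> omega),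
      kuhnVertex_swap τ x hs' (by split_ifs <;> omega)]
  · intro τ _ _ h
    have h1 := mul_eq_right.1 h
    rw [Equiv.swap_eq_one_iff] at h1
    simp at h1
  · simp
  · intro τ _
    simp [← mul_assoc]

/-- Taking the last direction first, from one unit further back, gives the neighbour across the
facet opposite the last vertex. -/
theorem kuhnVertex_rotate {e : ℕ} (τ : Equiv.Perm (Fin (e + 1))) (x : Fin (e + 1) → ℤ) {i : ℕ}
    (hi : i ≤ e) :
    kuhnVertex (finRotate (e + 1) * τ) (x - Pi.single (τ.symm (Fin.last e)) 1) (i + 1) =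
      kuhnVertex τ x i := by
  funext c
  simp only [kuhnVertex, Equiv.Perm.mul_apply, Pi.sub_apply]
  by_cases hc : τ c = Fin.last e
  · have : c = τ.symm (Fin.last e) := by simp [← hc]
    have hv : ((finRotate (e + 1) (τ c) : Fin (e + 1)) : ℕ) = 0 := by rw [hc, finRotate_last]; rfl
    have hv' : (τ c : ℕ) = e := by rw [hc]; rfl
    simp only [hv, hv', ← this, Pi.single_eq_same]
    simp [hi]
  · have : c ≠ τ.symm (Fin.last e) := fun h => hc (by simp [h])
    have hv := coe_finRotate_of_ne_last hc
    simp only [hv, Pi.single_eq_of_ne this]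
    simp

theorem kuhnSkip_rotate {e : ℕ} (f : (Fin (e + 1) → ℤ) → ZMod 2)
    (G : Fin e → (Fin (e + 1) → ℤ) → ZMod 2) {p : ℕ} (hp : p ≤ e) (x : Fin (e + 1) → ℤ)
    (τ : Equiv.Perm (Fin (e + 1))) :
    kuhnSkip f G (p + 1) 0 (x - Pi.single (τ.symm (Fin.last e)) 1) (finRotate (e + 1) * τ) =
      kuhnSkip f G p e x τ := by
  unfold kuhnSkip
  rw [kuhnVertex_rotate τ x hp]
  congr 1
  refine Finset.prod_congr rfl fun r _ => ?_
  have := r.2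
  simp only [not_lt_zero, if_false, this, if_true, kuhnDiff]
  rw [kuhnVertex_rotate τ x (by omega), kuhnVertex_rotate τ x (by omega)]

/-- The lattice function `g` takes the values `0` and `1` on the two opposite sides `y c ≤ 0` and
`N ≤ y c`. -/
def SeparatesSides {d : ℕ} (N : ℤ) (c : Fin d) (g : (Fin d → ℤ) → ZMod 2) : Prop :=
  ∀ y, (y c ≤ 0 → g y = 0) ∧ (N ≤ y c → g y = 1)

theorem kuhnVertex_bounds {d : ℕ} (τ : Equiv.Perm (Fin d)) (x : Fin d → ℤ) (i : ℕ) (c : Fin d) :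
    x c ≤ kuhnVertex τ x i c ∧ kuhnVertex τ x i c ≤ x c + 1 := by
  unfold kuhnVertex
  split_ifs <;> constructor <;> omega

theorem SeparatesSides.bounds {d : ℕ} {N : ℤ} {c : Fin d} {g : (Fin d → ℤ) → ZMod 2}
    (hg : SeparatesSides N c g) {τ : Equiv.Perm (Fin d)} {x : Fin d → ℤ} {i : ℕ}
    (h : kuhnDiff g τ x i ≠ 0) : 0 ≤ x c ∧ x c < N := by
  have h0 := kuhnVertex_bounds τ x i c
  have h1 := kuhnVertex_bounds τ x (i + 1) c
  constructor
  · by_contra! hlt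
    apply h
    rw [kuhnDiff, (hg _).1 (by omega), (hg _).1 (by omega), add_zero]
  · by_contra! hlt
    apply h
    rw [kuhnDiff, (hg _).2 (by omega), (hg _).2 (by omega)]
    decide

/-- Allows box sums to be read as translation-invariant sums over the whole lattice. -/
theorem kuhnSkip_support {e : ℕ} {N : ℤ} {k : Fin (e + 1)} {f : (Fin (e + 1) → ℤ) → ZMod 2}
    {G : Fin e → (Fin (e + 1) → ℤ) → ZMod 2} (hf : ∀ y, (y k ≤ 0 ∨ N ≤ y k) → f y = 0)
    (hG : ∀ r, SeparatesSides N (k.succAbove r) (G r)) {p s : ℕ} {x : Fin (e + 1) → ℤ}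
    {τ : Equiv.Perm (Fin (e + 1))} (h : kuhnSkip f G p s x τ ≠ 0) :
    x ∈ Finset.Icc (0 : Fin (e + 1) → ℤ) (fun _ => N) := by
  have h1 := left_ne_zero_of_mul h
  have h2 := Finset.prod_ne_zero_iff.1 (right_ne_zero_of_mul h)
  have h3 : ∀ c, 0 ≤ x c ∧ x c ≤ N := by
    intro c
    induction c using Fin.succAboveCases k with
    | x =>
      have h0 := kuhnVertex_bounds τ x p k
      by_contra hc
      exact h1 (hf _ (by omega))
    | p r =>
      have := (hG r).bounds (h2 r (Finset.mem_univ _))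
      omega
  rw [Finset.mem_Icc]
  exact ⟨fun c => (h3 c).1, fun c => (h3 c).2⟩

theorem sum_kuhnSkip_rotate {e : ℕ} {N : ℤ} {k : Fin (e + 1)} {f : (Fin (e + 1) → ℤ) → ZMod 2}
    {G : Fin e → (Fin (e + 1) → ℤ) → ZMod 2} (hf : ∀ y, (y k ≤ 0 ∨ N ≤ y k) → f y = 0)
    (hG : ∀ r, SeparatesSides N (k.succAbove r) (G r)) {p : ℕ} (hp : p ≤ e) :
    ∑ x ∈ Finset.Icc (0 : Fin (e + 1) → ℤ) (fun _ => N), ∑ τ, kuhnSkip f G (p + 1) 0 x τ =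
      ∑ x ∈ Finset.Icc (0 : Fin (e + 1) → ℤ) (fun _ => N), ∑ τ, kuhnSkip f G p e x τ := by
  have hfin : ∀ p s τ, ∑ x ∈ Finset.Icc (0 : Fin (e + 1) → ℤ) (fun _ => N), kuhnSkip f G p s x τ =
      ∑ᶠ x, kuhnSkip f G p s x τ := fun p s τ =>
    (finsum_eq_sum_of_support_subset _ fun x hx => kuhnSkip_support hf hG hx).symm
  rw [Finset.sum_comm, Finset.sum_comm (t := Finset.univ)]
  simp only [hfin]
  rw [← Equiv.sum_comp (Equiv.mulLeft (finRotate (e + 1)))]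
  refine Finset.sum_congr rfl fun τ _ => ?_
  rw [← finsum_comp_equiv (Equiv.subRight (Pi.single (τ.symm (Fin.last e)) (1 : ℤ)))]
  exact finsum_congr fun x => kuhnSkip_rotate f G hp x τ

theorem sum_kuhnSkip_antitone {e : ℕ} (f : (Fin (e + 1) → ℤ) → ZMod 2)
    (G : Fin e → (Fin (e + 1) → ℤ) → ZMod 2) {p a b : ℕ} (hab : a ≤ b) (hb : b ≤ e)
    (hp : p ≤ a ∨ b < p) (x : Fin (e + 1) → ℤ) :
    ∑ τ, kuhnSkip f G p a x τ = ∑ τ, kuhnSkip f G p b x τ := by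
  induction b, hab using Nat.le_induction with
  | base => rfl
  | succ b hab ih =>
    rw [ih (by omega) (by omega), sum_kuhnSkip_succ f G (by omega) (by omega)]

/-- The sum over all Kuhn simplices of the product of the increments of `g i` along the
`i`-th step. -/
noncomputable def kuhnSum {d : ℕ} (N : ℤ) (g : Fin d → (Fin d → ℤ) → ZMod 2) : ZMod 2 :=
  ∑ x ∈ Finset.Icc (0 : Fin d → ℤ) (fun _ => N), ∑ τ, ∏ i : Fin d, kuhnDiff (g i) τ x i

/-- The change is a sum of two terms, weighted by `h + g k` at the ends of step `k`. Sliding the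
skipped step down to 0, crossing to the neighbouring simplex, and sliding from `e` back to `k`
carries one term to the other. -/
theorem kuhnSum_update {e : ℕ} {N : ℤ} {g : Fin (e + 1) → (Fin (e + 1) → ℤ) → ZMod 2}
    (hg : ∀ i, SeparatesSides N i (g i)) (k : Fin (e + 1)) {h : (Fin (e + 1) → ℤ) → ZMod 2}
    (hh : SeparatesSides N k h) : kuhnSum N (Function.update g k h) = kuhnSum N g := by
  have hf : ∀ y : Fin (e + 1) → ℤ, (y k ≤ 0 ∨ N ≤ y k) → (h + g k) y = 0 := by
    rintro y (hy | hy)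
    · rw [Pi.add_apply, (hg k y).1 hy, (hh y).1 hy, add_zero]
    · rw [Pi.add_apply, (hg k y).2 hy, (hh y).2 hy]; decide
  have hG : ∀ r, SeparatesSides N (k.succAbove r) (g (k.succAbove r)) := fun r => hg _
  have hk : (k : ℕ) ≤ e := by omega
  have key : ∀ x τ, (∏ i : Fin (e + 1), kuhnDiff (Function.update g k h i) τ x i) +
      ∏ i : Fin (e + 1), kuhnDiff (g i) τ x i =
      kuhnSkip (h + g k) (fun r => g (k.succAbove r)) (k + 1) k x τ +
        kuhnSkip (h + g k) (fun r => g (k.succAbove r)) k k x τ := by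
    intro x τ
    have hr : ∀ r : Fin e, ((k.succAbove r : Fin (e + 1)) : ℕ) =
        if (r : ℕ) < k then (r : ℕ) else r + 1 := by
      intro r
      rw [Fin.succAbove]
      simp only [Fin.lt_def, Fin.val_castSucc]
      split_ifs <;> simp
    rw [Fin.prod_univ_succAbove _ k, Fin.prod_univ_succAbove (fun i => kuhnDiff (g i) τ x i) k]
    simp only [Function.update_self, Function.update_of_ne (Fin.succAbove_ne k _), hr, kuhnSkip,
      Pi.add_apply, kuhnDiff]
    ring
  rw [← CharTwo.add_eq_zero, kuhnSum, kuhnSum, ← Finset.sum_add_distrib]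
  simp only [← Finset.sum_add_distrib, key]
  simp only [Finset.sum_add_distrib]
  rw [CharTwo.add_eq_zero]
  calc _ = ∑ x ∈ Finset.Icc (0 : Fin (e + 1) → ℤ) (fun _ => N),
        ∑ τ, kuhnSkip (h + g k) (fun r => g (k.succAbove r)) (k + 1) 0 x τ :=
        Finset.sum_congr rfl fun x _ =>
          (sum_kuhnSkip_antitone _ _ (Nat.zero_le _) hk (by omega) x).symm
    _ = ∑ x ∈ Finset.Icc (0 : Fin (e + 1) → ℤ) (fun _ => N),
        ∑ τ, kuhnSkip (h + g k) (fun r => g (k.succAbove r)) k e x τ :=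
        sum_kuhnSkip_rotate hf hG hk
    _ = _ := Finset.sum_congr rfl fun x _ =>
          (sum_kuhnSkip_antitone _ _ hk le_rfl (by omega) x).symm

theorem kuhnSum_congr {e : ℕ} {N : ℤ} {g h : Fin (e + 1) → (Fin (e + 1) → ℤ) → ZMod 2}
    (hg : ∀ i, SeparatesSides N i (g i)) (hh : ∀ i, SeparatesSides N i (h i)) :
    kuhnSum N g = kuhnSum N h := by
  have : ∀ s : Finset (Fin (e + 1)), kuhnSum N (s.piecewise h g) = kuhnSum N g := by
    intro s
    induction s using Finset.induction_on with
    | empty => simp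
    | insert k s _ ih =>
      rw [Finset.piecewise_insert, kuhnSum_update _ k (hh k), ih]
      intro i
      by_cases hi : i ∈ s
      · simpa [hi] using hh i
      · simpa [hi] using hg i
  rw [← this Finset.univ, Finset.piecewise_univ]

theorem kuhnSum_step {d : ℕ} {N : ℤ} (hN : 0 < N) :
    kuhnSum N (fun (i : Fin d) y => if y i ≤ 0 then 0 else 1) = 1 := by
  have key : ∀ (x : Fin d → ℤ) (τ : Equiv.Perm (Fin d)),
      (∏ i : Fin d, kuhnDiff (fun y : Fin d → ℤ => if y i ≤ 0 then 0 else 1) τ x i) ≠ 0 →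
        x = 0 ∧ τ = 1 := by
    intro x τ h
    have h2 := Finset.prod_ne_zero_iff.1 h
    have h3 : ∀ i, x i = 0 ∧ τ i = i := by
      intro i
      have := h2 i (Finset.mem_univ _)
      rw [Fin.ext_iff]
      simp only [kuhnDiff, kuhnVertex] at this
      by_contra hc
      apply this
      split_ifs <;> first | omega | decide
    exact ⟨funext fun i => (h3 i).1, Equiv.ext fun i => (h3 i).2⟩
  rw [kuhnSum, Finset.sum_eq_single 0, Finset.sum_eq_single 1]
  · refine Finset.prod_eq_one fun i _ => ?_
    simp [kuhnDiff, kuhnVertex]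
  · intro τ _ hτ
    by_contra hc
    exact hτ (key _ _ hc).2
  · simp
  · intro x _ hx
    refine Finset.sum_eq_zero fun τ _ => ?_
    by_contra hc
    exact hx (key _ _ hc).1
  · intro h0
    exact absurd (Finset.mem_Icc.2 ⟨le_rfl, fun _ => hN.le⟩) h0

/-- Discrete Poincaré–Miranda theorem: some unit cube of the lattice is cut by every `g i`. -/
theorem exists_cube_cut {d : ℕ} {N : ℤ} (hN : 0 < N) {g : Fin d → (Fin d → ℤ) → ZMod 2}
    (hg : ∀ i, SeparatesSides N i (g i)) :
    ∃ x : Fin d → ℤ, (∀ i, 0 ≤ x i ∧ x i < N) ∧ ∀ i, ∃ y z : Fin d → ℤ,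
      (∀ c, x c ≤ y c ∧ y c ≤ x c + 1) ∧ (∀ c, x c ≤ z c ∧ z c ≤ x c + 1) ∧
        g i y = 0 ∧ g i z = 1 := by
  obtain _ | e := d
  · exact ⟨0, fun i => i.elim0, fun i => i.elim0⟩
  have h1 : kuhnSum N g = 1 := by
    rw [← kuhnSum_step (d := e + 1) hN]
    refine kuhnSum_congr hg fun i y => ⟨fun h => if_pos h, fun h => if_neg (by omega)⟩
  have h2 : kuhnSum N g ≠ 0 := by rw [h1]; decide
  obtain ⟨x, _, hx⟩ := Finset.exists_ne_zero_of_sum_ne_zero h2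
  obtain ⟨τ, _, hτ⟩ := Finset.exists_ne_zero_of_sum_ne_zero hx
  have h3 := fun i => Finset.prod_ne_zero_iff.1 hτ i (Finset.mem_univ _)
  refine ⟨x, fun i => (hg i).bounds (h3 i), fun i => ?_⟩
  have h4 := h3 i
  have h01 : ∀ a b : ZMod 2, a + b ≠ 0 → (a = 0 ∧ b = 1) ∨ (a = 1 ∧ b = 0) := by decide
  rcases h01 _ _ h4 with h | h
  · exact ⟨_, _, kuhnVertex_bounds τ x _, kuhnVertex_bounds τ x _, h.1, h.2⟩
  · exact ⟨_, _, kuhnVertex_bounds τ x _, kuhnVertex_bounds τ x _, h.2, h.1⟩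

/-! ### From lattice labels to the continuous theorem -/

theorem exists_approx_zero_of_cube {d : ℕ} {G : Fin d → (Fin d → ℝ) → ℝ}
    (h0 : ∀ i, ∀ x ∈ Set.Icc (0 : Fin d → ℝ) 1, x i = 0 → G i x ≤ 0)
    (h1 : ∀ i, ∀ x ∈ Set.Icc (0 : Fin d → ℝ) 1, x i = 1 → 0 ≤ G i x) (m : ℕ) :
    ∃ u ∈ Set.Icc (0 : Fin d → ℝ) 1, ∃ v w : Fin d → Fin d → ℝ,
      ∀ i, (dist (v i) u ≤ 1 / ((m : ℝ) + 1) ∧ G i (v i) ≤ 0) ∧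
        (dist (w i) u ≤ 1 / ((m : ℝ) + 1) ∧ 0 ≤ G i (w i)) := by
  have hm : (0 : ℝ) < (m : ℝ) + 1 := by positivity
  let q : (Fin d → ℤ) → Fin d → ℝ := fun y c => (y c : ℝ) / ((m : ℝ) + 1)
  -- Sign labels, forced on the two faces; `h0` and `h1` make the forced labels agree with the weak
  -- sign.
  let g : Fin d → (Fin d → ℤ) → ZMod 2 := fun i y =>
    if y i ≤ 0 then 0 else if (m : ℤ) + 1 ≤ y i then 1 else if 0 < G i (q y) then 1 else 0
  have hg : ∀ i, SeparatesSides ((m : ℤ) + 1) i (g i) := by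
    intro i y
    refine ⟨fun h => if_pos h, fun h => ?_⟩
    simp only [g]
    rw [if_neg (by omega), if_pos h]
  obtain ⟨x, hx, hcut⟩ := exists_cube_cut (by omega) hg
  have hq : ∀ y : Fin d → ℤ, (∀ c, x c ≤ y c ∧ y c ≤ x c + 1) →
      q y ∈ Set.Icc (0 : Fin d → ℝ) 1 ∧ dist (q y) (q x) ≤ 1 / ((m : ℝ) + 1) := by
    intro y hy
    refine ⟨⟨fun c => ?_, fun c => ?_⟩, ?_⟩
    · have : (0 : ℤ) ≤ y c := (hx c).1.trans (hy c).1
      have : (0 : ℝ) ≤ y c := by exact_mod_cast this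
      exact div_nonneg this hm.le
    · have : y c ≤ (m : ℤ) + 1 := by have := (hx c).2; have := (hy c).2; omega
      have : (y c : ℝ) ≤ (m : ℝ) + 1 := by exact_mod_cast this
      exact (div_le_one hm).2 this
    · refine (dist_pi_le_iff (by positivity)).2 fun c => ?_
      have e1 : (x c : ℝ) ≤ y c := by exact_mod_cast (hy c).1
      have e2 : (y c : ℝ) ≤ x c + 1 := by exact_mod_cast (hy c).2
      simp only [q]
      rw [Real.dist_eq, ← sub_div, abs_div, abs_of_pos hm]
      gcongr
      rw [abs_of_nonneg] <;> linarith
  choose y z hy hz hy0 hz1 using hcut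
  refine ⟨q x, (hq x fun c => ⟨le_rfl, by omega⟩).1, fun i => q (y i), fun i => q (z i), fun i =>
    ⟨⟨(hq _ (hy i)).2, ?_⟩, ⟨(hq _ (hz i)).2, ?_⟩⟩⟩
  · have h := hy0 i
    simp only [g] at h
    split_ifs at h with a b c
    · refine h0 i _ (hq _ (hy i)).1 ?_
      have := (hx i).1
      have := (hy i i).1
      have : y i i = 0 := by omega
      simp [q, this]
    · exact absurd h (by decide)
    · exact absurd h (by decide)
    · exact not_lt.1 c
  · have h := hz1 i
    simp only [g] at h
    split_ifs at h with a b c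
    · exact absurd h (by decide)
    · refine h1 i _ (hq _ (hz i)).1 ?_
      have := (hx i).2
      have := (hz i i).2
      have : z i i = (m : ℤ) + 1 := by omega
      simp only [q, this]
      push_cast
      exact div_self hm.ne'
    · exact c.le
    · exact absurd h (by decide)

/-- The Poincaré–Miranda theorem. -/
theorem exists_zero_of_cube {d : ℕ} {G : Fin d → (Fin d → ℝ) → ℝ} (hG : ∀ i, Continuous (G i))
    (h0 : ∀ i, ∀ x ∈ Set.Icc (0 : Fin d → ℝ) 1, x i = 0 → G i x ≤ 0)
    (h1 : ∀ i, ∀ x ∈ Set.Icc (0 : Fin d → ℝ) 1, x i = 1 → 0 ≤ G i x) :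
    ∃ x ∈ Set.Icc (0 : Fin d → ℝ) 1, ∀ i, G i x = 0 := by
  choose u hu v w hvw using exists_approx_zero_of_cube h0 h1
  obtain ⟨x, hx, φ, hφ, hlim⟩ := isCompact_Icc.tendsto_subseq hu
  have hsmall := (tendsto_one_div_add_atTop_nhds_zero_nat (𝕜 := ℝ)).comp hφ.tendsto_atTop
  have hnear : ∀ r : ℕ → Fin d → ℝ, (∀ m, dist (r m) (u m) ≤ 1 / ((m : ℝ) + 1)) →
      Filter.Tendsto (r ∘ φ) Filter.atTop (𝓝 x) := by
    intro r hr
    refine hlim.congr_dist (squeeze_zero (fun _ => dist_nonneg) (fun m => ?_) hsmall)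
    rw [dist_comm]
    exact hr (φ m)
  refine ⟨x, hx, fun i => le_antisymm ?_ ?_⟩
  · exact le_of_tendsto (((hG i).tendsto x).comp (hnear (fun m => v m i) fun m => (hvw m i).1.1))
      (Filter.Eventually.of_forall fun m => (hvw (φ m) i).1.2)
  · exact ge_of_tendsto (((hG i).tendsto x).comp (hnear (fun m => w m i) fun m => (hvw m i).2.1))
      (Filter.Eventually.of_forall fun m => (hvw (φ m) i).2.2)

/-! ### Chains with equal steps -/

/-- The running maximum of `0, x 0, …, x (d - 1), 1, 1, …`. -/
noncomputable def runningMax {d : ℕ} (x : Fin d → ℝ) : ℕ → ℝ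
  | 0 => 0
  | i + 1 => max (runningMax x i) (if h : i < d then x ⟨i, h⟩ else 1)

theorem continuous_runningMax {d : ℕ} (i : ℕ) :
    Continuous fun x : Fin d → ℝ => runningMax x i := by
  induction i with
  | zero => exact continuous_const
  | succ i ih =>
    refine ih.max ?_
    split_ifs
    · exact continuous_apply _
    · exact continuous_const

theorem monotone_runningMax {d : ℕ} (x : Fin d → ℝ) : Monotone (runningMax x) :=
  monotone_nat_of_le_succ fun _ => le_max_left _ _

theorem runningMax_le_one {d : ℕ} {x : Fin d → ℝ} (hx : x ≤ 1) (i : ℕ) : runningMax x i ≤ 1 := by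
  induction i with
  | zero => exact zero_le_one
  | succ i ih =>
    refine max_le ih ?_
    split_ifs
    · exact hx _
    · exact le_rfl

theorem runningMax_nonneg {d : ℕ} (x : Fin d → ℝ) (i : ℕ) : 0 ≤ runningMax x i :=
  monotone_runningMax x (Nat.zero_le i)

/-- A nonnegative continuous function of two points vanishing on the diagonal takes equal values
along the steps of some chain from `0` to `1` with a prescribed number of steps. -/
theorem exists_equal_steps {F : ℝ → ℝ → ℝ} (hF : Continuous fun p : ℝ × ℝ => F p.1 p.2)
    (hpos : ∀ s t, 0 ≤ F s t) (hdiag : ∀ s, F s s = 0) (d : ℕ) :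
    ∃ t : ℕ → ℝ, Monotone t ∧ t 0 = 0 ∧ t (d + 1) = 1 ∧
      ∃ D : ℝ, ∀ i ≤ d, F (t i) (t (i + 1)) = D := by
  have hc : ∀ i j, Continuous fun x : Fin d → ℝ => F (runningMax x i) (runningMax x j) :=
    fun i j => hF.comp ((continuous_runningMax i).prodMk (continuous_runningMax j))
  obtain ⟨x, hx, hzero⟩ := exists_zero_of_cube
    (G := fun (i : Fin d) x => F (runningMax x i) (runningMax x (i + 1)) -
      F (runningMax x (i + 1)) (runningMax x (i + 2)))
    (fun i => (hc i (i + 1)).sub (hc (i + 1) (i + 2)))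
    (by
      intro i x hx hi
      -- On this face step `i` is trivial; on the opposite face step `i + 1` is, both its ends being
      -- 1.
      have : runningMax x (i + 1) = runningMax x i := by
        rw [runningMax, dif_pos i.2, Fin.eta, hi]
        exact max_eq_left (runningMax_nonneg x i)
      rw [this, hdiag, zero_sub, neg_nonpos]
      exact hpos _ _)
    (by
      intro i x hx hi
      have e1 : runningMax x (i + 1) = 1 := by
        rw [runningMax, dif_pos i.2, Fin.eta, hi]
        exact max_eq_right (runningMax_le_one hx.2 i)
      have e2 : runningMax x (i + 2) = 1 := by
        refine le_antisymm (runningMax_le_one hx.2 _) ?_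
        rw [← e1]
        exact monotone_runningMax x (Nat.le_succ _)
      rw [e1, e2, hdiag, sub_zero]
      exact hpos _ _)
  refine ⟨runningMax x, monotone_runningMax x, rfl, ?_, F (runningMax x 0) (runningMax x 1), ?_⟩
  · rw [runningMax, dif_neg (lt_irrefl _)]
    exact max_eq_right (runningMax_le_one hx.2 _)
  · intro i hi
    induction i with
    | zero => rfl
    | succ i ih =>
      rw [← ih (by omega)]
      exact (sub_eq_zero.1 (hzero ⟨i, hi⟩)).symm

/-! ### Inscribed polygons of a closed curve -/

/-- What matters later is that the constants have ratio 5/3 < 2, the least number of remaining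
edges. -/
theorem HasStrictDerivAt.exists_norm_sub_bounds {E : Type*} [NormedAddCommGroup E]
    [NormedSpace ℝ E] {κ : ℝ → E} {v : E} (hv : v ≠ 0) (h : HasStrictDerivAt κ v 0) :
    ∃ δ > 0, δ ≤ 1 / 2 ∧ ∀ s t, |s| < δ → |t| < δ → s ≤ t →
      3 / 4 * ‖v‖ * (t - s) ≤ ‖κ s - κ t‖ ∧ ‖κ s - κ t‖ ≤ 5 / 4 * ‖v‖ * (t - s) := by
  have hv' : 0 < ‖v‖ := norm_pos_iff.2 hv
  have h1 := (hasStrictFDerivAt_iff_isLittleO.1 h.hasStrictFDerivAt).bound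
    (show (0 : ℝ) < ‖v‖ / 4 by positivity)
  obtain ⟨δ, hδ, hball⟩ := Metric.eventually_nhds_iff.1 h1
  refine ⟨min δ (1 / 2), lt_min hδ (by norm_num), min_le_right _ _, fun s t hs ht hst => ?_⟩
  have h2 := @hball (s, t) (by
    rw [Prod.dist_eq, Real.dist_eq, Real.dist_eq, sub_zero, sub_zero]
    exact max_lt (hs.trans_le (min_le_left _ _)) (ht.trans_le (min_le_left _ _)))
  simp only [ContinuousLinearMap.toSpanSingleton_apply] at h2
  have h3 : ‖(s - t) • v‖ = (t - s) * ‖v‖ := by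
    rw [norm_smul, Real.norm_eq_abs, abs_sub_comm, abs_of_nonneg (by linarith)]
  rw [Real.norm_eq_abs, abs_sub_comm, abs_of_nonneg (by linarith)] at h2
  have h4 := norm_sub_norm_le ((s - t) • v) (κ s - κ t)
  rw [norm_sub_rev _ (κ s - κ t)] at h4
  have h5 := norm_sub_norm_le (κ s - κ t) ((s - t) • v)
  constructor <;> nlinarith

/-- A closed curve `κ` of period `1` that visits `κ 0` only once, with nonzero derivative, has an
inscribed equilateral polygon with any number of edges, at least `3`, starting at `κ 0`. -/
theorem exists_equilateral_chain {E : Type*} [NormedAddCommGroup E] [NormedSpace ℝ E] {κ : ℝ → E}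
    (hκ : Continuous κ) (hper : ∀ s, κ (s + 1) = κ s) {v : E} (hv : v ≠ 0)
    (hderiv : HasStrictDerivAt κ v 0) (hsimple : ∀ s, 0 < s → s < 1 → κ s ≠ κ 0) {d : ℕ}
    (hd : 2 ≤ d) :
    ∃ t : ℕ → ℝ, t 0 = 0 ∧ t (d + 1) = 1 ∧ (∀ i ≤ d, t i < t (i + 1)) ∧
      ∃ D > 0, ∀ i ≤ d, ‖κ (t i) - κ (t (i + 1))‖ = D := by
  obtain ⟨δ, hδ, hδ2, hbd⟩ := hderiv.exists_norm_sub_bounds hv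
  obtain ⟨t, hmono, ht0, ht1, D, hD⟩ := exists_equal_steps
    (F := fun s t => ‖κ s - κ t‖ + max 0 (t - s - (1 - δ)))
    (by fun_prop) (fun s t => by positivity)
    (fun s => by
      rw [sub_self, norm_zero, zero_add, sub_self]
      exact max_eq_left (by linarith)) d
  have hD0 : 0 ≤ D := by
    rw [← hD 0 (Nat.zero_le _)]
    positivity
  have ht_nonneg : ∀ i, 0 ≤ t i := fun i => ht0 ▸ hmono (Nat.zero_le i)
  have ht_le : ∀ i ≤ d + 1, t i ≤ 1 := fun i hi => ht1 ▸ hmono hi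
  -- If D = 0, no step can leave 0: the penalty forbids reaching 1, and `hsimple` excludes
  -- everything between.
  have hDpos : 0 < D := by
    refine lt_of_le_of_ne hD0 fun hD0 => ?_
    have : ∀ i ≤ d + 1, t i = 0 := by
      intro i
      induction i with
      | zero => exact fun _ => ht0
      | succ i ih =>
        intro hi
        have h1 := hD i (by omega)
        rw [← hD0, ih (by omega)] at h1
        have h2 := norm_nonneg (κ 0 - κ (t (i + 1)))
        have h3 := le_max_left 0 (t (i + 1) - 0 - (1 - δ))
        have h4 := le_max_right 0 (t (i + 1) - 0 - (1 - δ))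
        have h5 : κ 0 = κ (t (i + 1)) := sub_eq_zero.1 (norm_eq_zero.1 (by linarith))
        by_contra hne
        exact hsimple _ (lt_of_le_of_ne (ht_nonneg _) (Ne.symm hne)) (by linarith) h5.symm
    have := this (d + 1) le_rfl
    linarith
  have hshort : ∀ i ≤ d, t (i + 1) - t i ≤ 1 - δ → ‖κ (t i) - κ (t (i + 1))‖ = D := by
    intro i hi h
    rw [← hD i hi, max_eq_left (by linarith), add_zero]
  have hnolong : ∀ k ≤ d, t (k + 1) - t k ≤ 1 - δ := by
    intro k hk
    by_contra! hlong
    have hk0 := ht_nonneg k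
    have hk1 := ht_le (k + 1) (by omega)
    -- Every vertex up to `k` lies within δ of 0, every later one within δ of 1; δ ≤ 1/2 makes all
    -- other steps short.
    have hleft : ∀ j ≤ k, j * D ≤ 5 / 4 * ‖v‖ * t j := by
      intro j
      induction j with
      | zero => intro _; simp [ht0]
      | succ j ih =>
        intro hj
        have h1 := ht_nonneg j
        have h2 : t j ≤ t (j + 1) := hmono (Nat.le_succ _)
        have h3 : t (j + 1) ≤ t k := hmono hj
        have h4 := hshort j (by omega) (by linarith)
        have h5 := (hbd (t j) (t (j + 1)) (by rw [abs_lt]; constructor <;> linarith)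
          (by rw [abs_lt]; constructor <;> linarith) h2).2
        have h6 := ih (by omega)
        push_cast
        linarith
    have hright : ∀ j, k + 1 + j ≤ d + 1 → j * D ≤ 5 / 4 * ‖v‖ * (t (k + 1 + j) - t (k + 1)) := by
      intro j
      induction j with
      | zero => intro _; simp
      | succ j ih =>
        intro hj
        have h1 : t (k + 1) ≤ t (k + 1 + j) := hmono (by omega)
        have h2 : t (k + 1 + j) ≤ t (k + 1 + j + 1) := hmono (Nat.le_succ _)
        have h3 := ht_le (k + 1 + j + 1) hj
        have h4 := hshort (k + 1 + j) (by omega) (by linarith)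
        have h5 := (hbd (t (k + 1 + j) - 1) (t (k + 1 + j + 1) - 1)
          (by rw [abs_lt]; constructor <;> linarith)
          (by rw [abs_lt]; constructor <;> linarith) (by linarith)).2
        rw [← hper, ← hper (t (k + 1 + j + 1) - 1), sub_add_cancel, sub_add_cancel, h4] at h5
        have h6 := ih (by omega)
        rw [← add_assoc]
        push_cast
        linarith
    have h1 := hleft k le_rfl
    have h2 := hright (d - k) (by omega)
    rw [show k + 1 + (d - k) = d + 1 by omega, ht1, Nat.cast_sub hk] at h2
    have h3 := (hbd (t (k + 1) - 1) (t k) (by rw [abs_lt]; constructor <;> linarith)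
      (by rw [abs_lt]; constructor <;> linarith) (by linarith)).1
    rw [← hper, sub_add_cancel, norm_sub_rev] at h3
    have h4 := hD k hk
    have h5 := le_max_left 0 (t (k + 1) - t k - (1 - δ))
    have h6 : (2 : ℝ) * D ≤ d * D := by
      have : (2 : ℝ) ≤ d := by exact_mod_cast hd
      gcongr
    -- With g = 1 - (t (k + 1) - t k), this gives 2D ≤ (5/4)‖v‖g and (3/4)‖v‖g ≤ D, impossible for D
    -- > 0.
    linarith
  refine ⟨t, ht0, ht1, fun i hi => ?_, D, hDpos, fun i hi => hshort i hi (hnolong i hi)⟩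
  refine lt_of_le_of_ne (hmono (Nat.le_succ _)) fun h => ?_
  have := hshort i hi (hnolong i hi)
  rw [← h, sub_self, norm_zero] at this
  exact hDpos.ne this

theorem HasNonzeroContinuousDerivNear.hasStrictDerivAt {E : Type*} [NormedAddCommGroup E]
    [NormedSpace ℝ E] {K : Circle → E} {a : ℝ}
    (h : HasNonzeroContinuousDerivNear K (Circle.exp a)) :
    ∃ v : E, v ≠ 0 ∧ HasStrictDerivAt (fun s : ℝ => K (Circle.exp (a + 2 * Real.pi * s))) v 0 := by
  obtain ⟨U, hU, hdiff, hcont⟩ := h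
  have hpre : {θ : ℝ | Circle.exp θ ∈ U} ∈ 𝓝 a :=
    (Circle.exp.continuous.tendsto a) hU
  have h1 : HasStrictDerivAt (fun s : ℝ => K (Circle.exp s))
      (deriv (fun s : ℝ => K (Circle.exp s)) a) a :=
    hasStrictDerivAt_of_hasDerivAt_of_continuousAt
      (Filter.mem_of_superset hpre fun θ hθ => (hdiff θ hθ).1.hasDerivAt)
      (hcont.continuousAt hpre)
  have h2 : HasStrictDerivAt (fun s : ℝ => a + 2 * Real.pi * s) (2 * Real.pi) 0 := by
    simpa using ((hasStrictDerivAt_id (0 : ℝ)).const_mul (2 * Real.pi)).const_add a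
  refine ⟨(2 * Real.pi) • deriv (fun s : ℝ => K (Circle.exp s)) a,
    smul_ne_zero Real.two_pi_pos.ne' (hdiff a (mem_of_mem_nhds hU)).2, ?_⟩
  exact HasStrictDerivAt.scomp_of_eq 0 h1 h2 (by simp)

theorem isInscribedRegularPolygon_of_chain {E : Type*} [NormedAddCommGroup E]
    (K : Circle → E) (a : ℝ) {d : ℕ} {t : ℕ → ℝ} (ht0 : t 0 = 0)
    (ht1 : t (d + 1) = 1) (hlt : ∀ i ≤ d, t i < t (i + 1)) {D : ℝ} (hD : 1 ≤ d → 0 < D)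
    (hedge : ∀ i ≤ d, ‖K (Circle.exp (a + 2 * Real.pi * t i)) -
      K (Circle.exp (a + 2 * Real.pi * t (i + 1)))‖ = D) :
    IsInscribedRegularPolygon K (d + 1) fun i => Circle.exp (a + 2 * Real.pi * t i) := by
  have hmono : StrictMono fun i : Fin (d + 2) => t i :=
    Fin.strictMono_iff_lt_succ.2 fun i => hlt i (by omega)
  refine ⟨⟨fun i => a + 2 * Real.pi * t i, fun i j hij => ?_, fun i j => ?_, fun i => rfl⟩,
    D, fun h => hD (by omega), fun i => ?_⟩
  · have := hmono (show i.castSucc < j.castSucc from hij)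
    have hpi := Real.two_pi_pos
    simp only [Fin.val_castSucc] at this ⊢
    gcongr
  · have h1 : t j < t (d + 1) := hmono (Fin.castSucc_lt_last j)
    have h2 : t 0 ≤ t i := hmono.monotone (Fin.zero_le i.castSucc)
    rw [ht1] at h1
    rw [ht0] at h2
    have hpi := Real.two_pi_pos
    nlinarith
  · rw [← hedge i (by omega)]
    -- The closing edge returns to vertex 0, which is also the point of parameter `t (d + 1) = 1`.
    by_cases hi : i = Fin.last d
    · have h1 : ((finRotate (d + 1) i : Fin (d + 1)) : ℕ) = 0 := by rw [hi, finRotate_last]; rfl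
      have h2 : (i : ℕ) = d := by rw [hi]; rfl
      simp only [h1]
      rw [h2, ht0, ht1, mul_zero, add_zero, mul_one, Circle.exp_add a (2 * Real.pi),
        Circle.exp_two_pi, mul_one]
    · simp only [coe_finRotate_of_ne_last hi]

theorem theorem5 (m : ℕ) (K : Circle → EuclideanSpace ℝ (Fin m)) (hK : Continuous K)
    (x₀ : Circle) (hderiv : HasNonzeroContinuousDerivNear K x₀)
    (hsimple : ∀ x : Circle, x ≠ x₀ → K x ≠ K x₀) (n : ℕ) (hn : 1 ≤ n) :
    ∃ x : Fin n → Circle, IsInscribedRegularPolygon K n x ∧ ∃ i, x i = x₀ := by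
  obtain ⟨d, rfl⟩ : ∃ d, n = d + 1 := ⟨n - 1, by omega⟩
  obtain ⟨a, rfl⟩ : ∃ a : ℝ, Circle.exp a = x₀ := ⟨_, Circle.exp_arg x₀⟩
  have hsimple' : ∀ s : ℝ, 0 < s → s < 1 → K (Circle.exp (a + 2 * Real.pi * s)) ≠
      K (Circle.exp (a + 2 * Real.pi * 0)) := by
    intro s hs0 hs1
    rw [mul_zero, add_zero]
    refine hsimple _ fun h => ?_
    rw [Circle.exp_add, mul_eq_left, Circle.exp_eq_one] at h
    obtain ⟨k, hk⟩ := h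
    have hk' : s = k := by
      have := Real.two_pi_pos
      apply mul_left_cancel₀ this.ne'
      linarith
    rw [hk'] at hs0 hs1
    have h0 : (0 : ℤ) < k := by exact_mod_cast hs0
    have h1 : k < (1 : ℤ) := by exact_mod_cast hs1
    omega
  suffices ∃ t : ℕ → ℝ, t 0 = 0 ∧ t (d + 1) = 1 ∧ (∀ i ≤ d, t i < t (i + 1)) ∧
      ∃ D : ℝ, (1 ≤ d → 0 < D) ∧ ∀ i ≤ d, ‖K (Circle.exp (a + 2 * Real.pi * t i)) -
        K (Circle.exp (a + 2 * Real.pi * t (i + 1)))‖ = D by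
    obtain ⟨t, ht0, ht1, hlt, D, hD, hedge⟩ := this
    exact ⟨_, isInscribedRegularPolygon_of_chain K a ht0 ht1 hlt hD hedge, 0, by simp [ht0]⟩
  have hper : ∀ s : ℝ, K (Circle.exp (a + 2 * Real.pi * (s + 1))) =
      K (Circle.exp (a + 2 * Real.pi * s)) := by
    intro s
    rw [mul_add, mul_one, ← add_assoc, Circle.exp_add _ (2 * Real.pi), Circle.exp_two_pi, mul_one]
  rcases lt_or_ge d 2 with hd | hd
  -- For one or two vertices, equal spacing works: a 2-gon traverses the same chord twice.
  · have hlt : ∀ i : ℕ, (i : ℝ) / (d + 1) < ((i + 1 : ℕ) : ℝ) / (d + 1) := fun i => by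
      gcongr
      exact_mod_cast Nat.lt_succ_self i
    refine ⟨fun i => i / (d + 1), by simp, ?_, fun i _ => hlt i, ?_⟩
    · push_cast
      exact div_self (by positivity)
    interval_cases d
    · exact ⟨0, by simp, fun i hi => by simp [Nat.le_zero.1 hi, Circle.exp_add]⟩
    · refine ⟨‖K (Circle.exp (a + 2 * Real.pi * 0)) - K (Circle.exp (a + 2 * Real.pi * (1 / 2)))‖,
        fun _ => norm_pos_iff.2 (sub_ne_zero.2 (hsimple' _ (by norm_num) (by norm_num)).symm), ?_⟩
      intro i hi
      interval_cases i
      · norm_num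
      · have := hper 0
        rw [zero_add] at this
        rw [← this, norm_sub_rev]
        norm_num
  · obtain ⟨v, hv, hstrict⟩ := hderiv.hasStrictDerivAt
    obtain ⟨t, ht0, ht1, hlt, D, hD, hedge⟩ := exists_equilateral_chain
      (κ := fun s : ℝ => K (Circle.exp (a + 2 * Real.pi * s)))
      (hK.comp (Circle.exp.continuous.comp (by fun_prop))) hper hv hstrict hsimple' hd
    exact ⟨t, ht0, ht1, hlt, D, fun _ => hD, hedge⟩
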